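/- Let $d\ge 3$ be odd and let $k,n$ be integers with $2\le n\le k^{d-1}$. Write $[k]=\{1,\dots,k\}$ and order $[k]^d$ lexicographically. A slice of $[k]^d$ is the set of its elements with one fixed coordinate $x_\ell=i$; a set $T\subseteq[k]^d$ is magic if all slices of $[k]^d$ (in all $d$ directions) contain the same number of elements of $T$. For a magic set $T$ with $|T|=nk$, let $\mathcal C_d(k,T)$ be the set of functions $C:[k]^d\to\{0,1,\dots,n\}$ that are nonzero exactly on $T$ and such that, for every slice, the nonzero values of $C$ on the slice, read in lexicographic order of the cells, form a permutation of $[n]$. Let $\mathrm{sgn}(C)$ be the product of the signs of these permutations over all $dk$ slices, and $AT_d(k,T)=\sum_{C\in\mathcal C_d(k,T)}\mathrm{sgn}(C)$. A $d\times nk$ table $S$ with entries in $[k]$ is balanced if each row contains each element of $[k]$ exactly $n$ times. For a hypermatrix $X\in(\mathbb C^n)^{\otimes d}$ put $$\Delta_S(X)=\sum_{\sigma_1,\dots,\sigma_d:[nk]\to[n]}\ \prod_{\ell=1}^d\prod_{j=1}^k \mathrm{sgn}\big(\sigma_\ell|_{S_\ell^{-1}(j)}\big)\ \prod_{m=1}^{nk}X_{\sigma_1(m),\dots,\sigma_d(m)},$$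 where $S_\ell^{-1}(j)$ is the set of columns in which row $\ell$ has the entry $j$, and the sign is that of the sequence of the values of $\sigma_\ell$ in increasing order of these columns ($0$ if it is not a permutation of $[n]$). For a magic set $T$ with $|T|=nk$, $\Delta_T$ is $\Delta_S$ for the table $S$ whose columns are the elements of $T$ in lexicographic order. $I_n=(\delta_{i_1i_2}\cdots\delta_{i_1i_d})$ is the unit tensor. In $\bigwedge(\mathbb C^k)^{\otimes d}$, for $P\subseteq[k]^d$ let $\psi_P$ be the wedge product, in lexicographic order, of the tensors $e_{x_1}\otimes\cdots\otimes e_{x_d}$ with $x\in P$; let $\mathcal B_{d,k}(i)$ be the span of the $\psi_P$ for the magic sets $P$ of cardinality $ik$; and let $$\omega=\sum_{\pi_2,\dots,\pi_d\in S_k}\mathrm{sgn}(\pi_2\cdots\pi_d)\bigwedge_{i=1}^k e_i\otimes e_{\pi_2(i)}\otimes\cdots\otimes e_{\pi_d(i)},\qquad \omega^i=\underbrace{\omega\wedge\cdots\wedge\omega}_{i}.$$ A highest weight vector is a nonzero weight vector for $\mathrm{GL}(k)^{\times d}$ that is annihilated by all raising operators, that is, by the elements of the Lie algebra with $E_{i,j}$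 ($i<j$) in one component and $0$ in the others. Then $\Delta_T(I_n)=AT_d(k,T)$ for every magic set $T\subseteq[k]^d$ of cardinality $nk$, and the following statements are equivalent: (1) $\omega^n\ne0$. (2) $\Delta_T(I_n)=AT_d(k,T)\ne0$ for some magic set $T\subseteq[k]^d$ of cardinality $nk$. (2') $\Delta_S(I_n)\ne0$ for some balanced $d\times nk$ table $S$. (3) For all $1\le i\le n$, $\omega^i\in\mathcal B_{d,k}(i)$ and $\omega^i$ is a highest weight vector, of weight $(i,\dots,i)$ in each of the $d$ components. -/

import Mathlib

noncomputable section

namespace HyperDet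

/-! ### Words, cells, slices -/

/-- The sign of a word `a₁ … aₙ` over an alphabet of `n` letters: the usual sign if the word is a
permutation of the alphabet, and `0` otherwise. -/
def permSign {n : ℕ} (a : Fin n → Fin n) : ℤ :=
  open Classical in
  if h : Function.Bijective a then (Equiv.Perm.sign (Equiv.ofBijective a h) : ℤ) else 0

/-- The sign of the word obtained by listing the values of `f` on the finite set `A` in increasing
order of the elements of `A`. It is `0` when this word is not a permutation of the `n` letters (in
particular when `A` does not have `n` elements). -/
def wordSign {α : Type*} [LinearOrder α] {n : ℕ} (A : Finset α) (f : α → Fin n) : ℤ :=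
  if h : A.card = n then permSign (fun i => f (A.orderEmbOfFin h i)) else 0

/-- The values of `f` on `A`, listed in increasing order of the elements of `A`, form a
permutation of the `n` letters. -/
def IsPermWord {α : Type*} [LinearOrder α] {n : ℕ} (A : Finset α) (f : α → Fin n) : Prop :=
  ∃ h : A.card = n, Function.Bijective (fun i => f (A.orderEmbOfFin h i))

/-- The cells of the box `[k]^d`, with the lexicographic order. The set `[k]` is `Fin k`. -/
abbrev Cell (d k : ℕ) : Type := Lex (Fin d → Fin k)

/-- The `l`-th coordinate of a cell. -/
def coord {d k : ℕ} (x : Cell d k) (l : Fin d) : Fin k := ofLex x l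

/-- A magic set: a set of cells with the same number of elements in every slice of the box
(over all directions `l` and all values `i` of the fixed coordinate). -/
def IsMagic {d k : ℕ} (T : Finset (Cell d k)) : Prop :=
  ∃ m : ℕ, ∀ (l : Fin d) (i : Fin k), (T.filter (fun x => coord x l = i)).card = m

/-! ### Partial Latin hypercubes and Alon--Tarsi numbers -/

/-- The cells of `T` in the `i`-th slice in direction `l`, as a set of elements of the ordered
subtype `T`. -/
def sliceOf {d k : ℕ} (T : Finset (Cell d k)) (l : Fin d) (i : Fin k) : Finset {x // x ∈ T} :=
  Finset.univ.filter (fun x => coord x.1 l = i)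

/-- `C` is a partial Latin hypercube of type `T`, length `k` and cardinality `n * k`. A hypercube
with values in `{0, 1, …, n}` whose nonzero cells are exactly those of `T` is given by its nonzero
values, that is, by a function `C` from `T` to the `n` symbols. -/
structure IsPartialLatin {d k n : ℕ} (T : Finset (Cell d k)) (C : {x // x ∈ T} → Fin n) : Prop where
  magic : IsMagic T
  card_eq : T.card = n * k
  slice : ∀ (l : Fin d) (i : Fin k), IsPermWord (sliceOf T l i) C

/-- The directional sign: the product of the signs of the permutations that `C` defines on the
slices in direction `l`. -/
def dirSign {d k n : ℕ} (T : Finset (Cell d k)) (C : {x // x ∈ T} → Fin n) (l : Fin d) : ℤ :=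
  ∏ i : Fin k, wordSign (sliceOf T l i) C

/-- The full sign: the product of the directional signs. -/
def fullSign {d k n : ℕ} (T : Finset (Cell d k)) (C : {x // x ∈ T} → Fin n) : ℤ :=
  ∏ l : Fin d, dirSign T C l

/-- The `d`-dimensional Alon--Tarsi number `AT_d(k, T)` of a set `T` of `n * k` cells. -/
def alonTarsi {d k : ℕ} (n : ℕ) (T : Finset (Cell d k)) : ℤ :=
  open Classical in
  ∑ C : {x // x ∈ T} → Fin n with IsPartialLatin T C, fullSign T C

/-! ### The invariant polynomials `Δ` -/

/-- The block of column indices at which row `l` of the table `S` has the entry `j`. -/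
def block {d k M : ℕ} (S : Fin d → Fin M → Fin k) (l : Fin d) (j : Fin k) : Finset (Fin M) :=
  Finset.univ.filter (fun m => S l m = j)

/-- A `d × M` table with entries in `[k]` is balanced (for the format `n × ⋯ × n`) if every row
contains every element of `[k]` exactly `n` times. -/
def IsBalanced {d k M : ℕ} (n : ℕ) (S : Fin d → Fin M → Fin k) : Prop :=
  ∀ (l : Fin d) (j : Fin k), (block S l j).card = n

/-- The polynomial `Δ_S` of the balanced table `S`, evaluated at the `n × ⋯ × n` hypermatrix `X`. -/
def Delta {d k M n : ℕ} (S : Fin d → Fin M → Fin k) (X : (Fin d → Fin n) → ℂ) : ℂ :=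
  ∑ σ : Fin d → Fin M → Fin n,
    ((∏ l : Fin d, ∏ j : Fin k, wordSign (block S l j) (σ l) : ℤ) : ℂ) *
      ∏ m : Fin M, X (fun l => σ l m)

/-- The unit tensor `I_n`, as a `d`-dimensional hypermatrix. -/
def unitTensor (d n : ℕ) : (Fin d → Fin n) → ℂ :=
  fun x => if ∀ l l' : Fin d, x l = x l' then 1 else 0

/-- The `d × M` table whose columns are the `M` elements of `T` in lexicographic order. -/
def tableOf {d k M : ℕ} (T : Finset (Cell d k)) (h : T.card = M) : Fin d → Fin M → Fin k :=
  fun l m => coord (T.orderEmbOfFin h m) l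

/-! ### The exterior algebra of `(ℂ^k)^{⊗ d}` and highest weight vectors -/

/-- The tensor space `(ℂ^k)^{⊗ d}`. -/
abbrev TensorSpace (d k : ℕ) : Type := PiTensorProduct ℂ (fun _ : Fin d => (Fin k → ℂ))

/-- The exterior algebra of `(ℂ^k)^{⊗ d}`. -/
abbrev Ext (d k : ℕ) : Type := ExteriorAlgebra ℂ (TensorSpace d k)

/-- The action of a `d`-tuple of matrices on the tensor space, factor by factor. -/
def tensorAct {d k : ℕ} (g : Fin d → Matrix (Fin k) (Fin k) ℂ) :
    TensorSpace d k →ₗ[ℂ] TensorSpace d k :=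
  PiTensorProduct.map (fun l => Matrix.toLin' (g l))

/-- The induced action on the exterior algebra; restricted to tuples of invertible matrices, this
is the action of `GL(k)^d`. -/
def extAct {d k : ℕ} (g : Fin d → Matrix (Fin k) (Fin k) ℂ) : Ext d k →ₐ[ℂ] Ext d k :=
  ExteriorAlgebra.map (tensorAct g)

/-- The algebra map `x ↦ x + ε D x` to the dual numbers over the exterior algebra, where `D` is
the derivation that extends the linear map `f`. -/
def dualLift {V : Type*} [AddCommGroup V] [Module ℂ V] (f : V →ₗ[ℂ] V) :
    ExteriorAlgebra ℂ V →ₐ[ℂ] TrivSqZeroExt (ExteriorAlgebra ℂ V) (ExteriorAlgebra ℂ V) :=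
  ExteriorAlgebra.lift ℂ
    ⟨(TrivSqZeroExt.inlAlgHom ℂ (ExteriorAlgebra ℂ V) (ExteriorAlgebra ℂ V)).toLinearMap ∘ₗ
        ExteriorAlgebra.ι ℂ +
      (TrivSqZeroExt.inrHom (ExteriorAlgebra ℂ V) (ExteriorAlgebra ℂ V)).restrictScalars ℂ ∘ₗ
        ExteriorAlgebra.ι ℂ ∘ₗ f, by
      intro m
      apply TrivSqZeroExt.ext
      · simp
      · simp [ExteriorAlgebra.ι_add_mul_swap]⟩

/-- The derivation of the exterior algebra that extends `f`, so that
`D (x₁ ∧ ⋯ ∧ xₘ) = ∑ⱼ x₁ ∧ ⋯ ∧ f xⱼ ∧ ⋯ ∧ xₘ`. -/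
def extDer {V : Type*} [AddCommGroup V] [Module ℂ V] (f : V →ₗ[ℂ] V) :
    ExteriorAlgebra ℂ V →ₗ[ℂ] ExteriorAlgebra ℂ V where
  toFun v := (dualLift f v).snd
  map_add' v w := by simp
  map_smul' c v := by simp

theorem extDer_ι {V : Type*} [AddCommGroup V] [Module ℂ V] (f : V →ₗ[ℂ] V) (x : V) :
    extDer f (ExteriorAlgebra.ι ℂ x) = ExteriorAlgebra.ι ℂ (f x) := by
  simp [extDer, dualLift]

theorem dualLift_fst {V : Type*} [AddCommGroup V] [Module ℂ V] (f : V →ₗ[ℂ] V)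
    (v : ExteriorAlgebra ℂ V) : (dualLift f v).fst = v := by
  induction v using ExteriorAlgebra.induction with
  | algebraMap r => simp [TrivSqZeroExt.algebraMap_eq_inl']
  | ι x => simp [dualLift]
  | mul a b ha hb => simp [ha, hb]
  | add a b ha hb => simp [ha, hb]

theorem extDer_mul {V : Type*} [AddCommGroup V] [Module ℂ V] (f : V →ₗ[ℂ] V)
    (v w : ExteriorAlgebra ℂ V) : extDer f (v * w) = extDer f v * w + v * extDer f w := by
  simp [extDer, dualLift_fst, add_comm]

theorem extDer_algebraMap {V : Type*} [AddCommGroup V] [Module ℂ V] (f : V →ₗ[ℂ] V) (r : ℂ) :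
    extDer f (algebraMap ℂ (ExteriorAlgebra ℂ V) r) = 0 := by
  simp [extDer, TrivSqZeroExt.algebraMap_eq_inl']

/-- The action of the Lie algebra element with `A` in the `l`-th component and zero elsewhere. -/
def lieAct {d k : ℕ} (l : Fin d) (A : Matrix (Fin k) (Fin k) ℂ) : Ext d k →ₗ[ℂ] Ext d k :=
  extDer (tensorAct (Function.update 1 l A))

theorem exists_expansion {V : Type*} [AddCommGroup V] [Module ℂ V] (f : V →ₗ[ℂ] V)
    (v : ExteriorAlgebra ℂ V) :
    ∃ p : Polynomial (ExteriorAlgebra ℂ V), p.coeff 0 = v ∧ p.coeff 1 = extDer f v ∧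
      ∀ ε : ℂ, ExteriorAlgebra.map (1 + ε • f) v =
        p.eval (algebraMap ℂ (ExteriorAlgebra ℂ V) ε) := by
  induction v using ExteriorAlgebra.induction with
  | algebraMap r =>
    refine ⟨Polynomial.C (algebraMap _ _ r), by simp, ?_, fun ε => by simp⟩
    rw [extDer_algebraMap, Polynomial.coeff_C_of_ne_zero one_ne_zero]
  | ι x =>
    refine ⟨Polynomial.C (ExteriorAlgebra.ι ℂ x) +
      Polynomial.C (ExteriorAlgebra.ι ℂ (f x)) * Polynomial.X, by simp, ?_, fun ε => ?_⟩
    · simp [extDer_ι, Polynomial.coeff_C]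
    · simp only [ExteriorAlgebra.map_apply_ι, LinearMap.add_apply, Module.End.one_apply,
        LinearMap.smul_apply, map_add, map_smul, Polynomial.eval_add, Polynomial.eval_C,
        Polynomial.eval_mul_X]
      rw [Algebra.smul_def, Algebra.commutes]
  | mul a b ha hb =>
    obtain ⟨p, p0, p1, hp⟩ := ha
    obtain ⟨q, q0, q1, hq⟩ := hb
    refine ⟨p * q, by simp [Polynomial.mul_coeff_zero, p0, q0], ?_, fun ε => ?_⟩
    · rw [Polynomial.mul_coeff_one, extDer_mul, p0, q0, p1, q1, add_comm]
    · rw [map_mul, hp, hq, Polynomial.eval, Polynomial.eval, Polynomial.eval,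
        Polynomial.eval₂_mul_noncomm]
      intro i
      exact (Algebra.commutes ε _).symm
  | add a b ha hb =>
    obtain ⟨p, p0, p1, hp⟩ := ha
    obtain ⟨q, q0, q1, hq⟩ := hb
    exact ⟨p + q, by simp [p0, q0], by simp [p1, q1], fun ε => by simp [hp, hq]⟩

theorem tensorAct_update {d k : ℕ} (l : Fin d) (A : Matrix (Fin k) (Fin k) ℂ) (ε : ℂ) :
    tensorAct (Function.update 1 l (1 + ε • A)) =
      1 + ε • tensorAct (Function.update 1 l A) := by
  have h : ∀ B : Matrix (Fin k) (Fin k) ℂ, tensorAct (Function.update (1 : Fin d → _) l B) =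
      PiTensorProduct.map (Function.update
        (fun _ => (1 : (Fin k → ℂ) →ₗ[ℂ] (Fin k → ℂ))) l (Matrix.toLin' B)) := by
    intro B
    unfold tensorAct
    congr 1
    funext j
    by_cases hj : j = l
    · subst hj; simp
    · simp [hj, Module.End.one_eq_id]
  rw [h, h, map_add, map_smul, PiTensorProduct.map_update_add, PiTensorProduct.map_update_smul]
  congr 1
  rw [Matrix.toLin'_one, ← Module.End.one_eq_id, Function.update_eq_self_iff.2 rfl,
    PiTensorProduct.map_one]

/-- `lieAct` is the differential of the group action: `A v = lim ((1 + ε A) v - v) / ε`, with the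
limit taken in the coordinates given by the linear functionals. -/
theorem hasDerivAt_extAct {d k : ℕ} (l : Fin d) (A : Matrix (Fin k) (Fin k) ℂ) (v : Ext d k)
    (φ : Module.Dual ℂ (Ext d k)) :
    HasDerivAt (fun ε : ℂ => φ (extAct (Function.update 1 l (1 + ε • A)) v))
      (φ (lieAct l A v)) 0 := by
  obtain ⟨p, -, p1, hp⟩ := exists_expansion (tensorAct (Function.update 1 l A)) v
  let q : Polynomial ℂ := ∑ i ∈ Finset.range (p.natDegree + 2),
    Polynomial.monomial i (φ (p.coeff i))
  have hq : ∀ ε : ℂ, φ (extAct (Function.update 1 l (1 + ε • A)) v) = q.eval ε := by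
    intro ε
    rw [extAct, tensorAct_update, hp,
      Polynomial.eval_eq_sum_range' (n := p.natDegree + 2) (by omega)]
    simp only [q, map_sum, Polynomial.eval_finsetSum, Polynomial.eval_monomial]
    refine Finset.sum_congr rfl fun i _ => ?_
    rw [← map_pow, ← Algebra.commutes, ← Algebra.smul_def, map_smul, smul_eq_mul, mul_comm]
  have h1 : q.derivative.eval 0 = φ (lieAct l A v) := by
    rw [← Polynomial.coeff_zero_eq_eval_zero, Polynomial.coeff_derivative]
    simp [q, Polynomial.coeff_monomial, p1, lieAct]
  rw [funext hq, ← h1]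
  exact q.hasDerivAt 0

/-- The raising operator `E_{i,j}` in direction `l` (used for `i < j`). -/
def raising {d k : ℕ} (l : Fin d) (i j : Fin k) : Ext d k →ₗ[ℂ] Ext d k :=
  lieAct l (Matrix.single i j 1)

/-- `v` is rescaled by the diagonal matrices in `GL(k)^d` through the weight `μ`. -/
def IsWeightVector {d k : ℕ} (μ : Fin d → Fin k → ℕ) (v : Ext d k) : Prop :=
  ∀ a : Fin d → Fin k → ℂˣ,
    extAct (fun l => Matrix.diagonal (fun i => (a l i : ℂ))) v =
      (∏ l : Fin d, ∏ i : Fin k, (a l i : ℂ) ^ μ l i) • v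

/-- A highest weight vector of weight `μ`: a nonzero weight vector of weight `μ` that vanishes
under all raising operators. -/
structure IsHighestWeightVector {d k : ℕ} (μ : Fin d → Fin k → ℕ) (v : Ext d k) : Prop where
  ne_zero : v ≠ 0
  weight : IsWeightVector μ v
  raising_eq_zero : ∀ (l : Fin d) (i j : Fin k), i < j → raising l i j v = 0

/-! ### The weight spaces and the hyperdeterminantal form -/

/-- The basis tensor `e_{x_1} ⊗ ⋯ ⊗ e_{x_d}`. -/
def basisTensor {d k : ℕ} (x : Fin d → Fin k) : TensorSpace d k :=
  PiTensorProduct.tprod ℂ (fun l => Pi.single (x l) (1 : ℂ))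

/-- The vector `ψ_P`: the wedge product of the basis tensors of the cells of `P`, in
lexicographic order. -/
def psi {d k : ℕ} (P : Finset (Cell d k)) : Ext d k :=
  ExteriorAlgebra.ιMulti ℂ P.card (fun i => basisTensor (ofLex (P.orderEmbOfFin rfl i)))

/-- The space `B_{d,k}(n)`, spanned by the `ψ_P` for the magic sets `P` of cardinality `n * k`. -/
def magicSpace (d k n : ℕ) : Submodule ℂ (Ext d k) :=
  Submodule.span ℂ {v | ∃ P : Finset (Cell d k), IsMagic P ∧ P.card = n * k ∧ v = psi P}

/-- The hyperdeterminantal form `ω`: the sum over the tuples `(π_1, …, π_d)` of permutations with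
`π_1 = id` of `sgn(π_2 ⋯ π_d)` times the wedge product over `i = 1, …, k` of
`e_i ⊗ e_{π_2(i)} ⊗ ⋯ ⊗ e_{π_d(i)}`. -/
def omega (d k : ℕ) : Ext d k :=
  open Classical in
  ∑ π : Fin d → Equiv.Perm (Fin k) with (∀ l : Fin d, (l : ℕ) = 0 → π l = 1),
    ((∏ l : Fin d, (Equiv.Perm.sign (π l) : ℤ) : ℤ) : ℂ) •
      ExteriorAlgebra.ιMulti ℂ k (fun i => basisTensor (fun l => π l i))

end HyperDet

end

open HyperDet

noncomputable section

namespace HyperDet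

/-! ### Signs of words -/

/-! Up to sign, the numbers `Δ_S(I_n)` are the coordinates of `ω ^ n`, so `ω ^ n` vanishes exactly
when all of them do.

At the unit tensor only `σ₁ = ⋯ = σ_d = C` contributes, and `Δ_S(I_n)` becomes the sum over fillings
`C` of the columns of the product of block signs. For the table of a magic set this is the
Alon–Tarsi sum. Expanding `ω ^ n` gives `n` normalized tuples of permutations, that is, `nk` basis
tensors on an `n × k` grid. The form `tableForm S` matches the columns of `S` with grid positions by
a permutation `σ`, and `C m` is the factor that column `m` is matched to. For each direction `l` the
word `m ↦ (C m, S l m)` has its sign computed twice: by columns of the grid it is the product of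
block signs, up to a sign independent of `C`; by rows it is the product of the signs of the chosen
permutations times `sgn σ`. Over all directions `sgn σ` occurs `d` times, and one copy remains since
`d` is odd (`sum_normalizedTuples_eq`, `exists_tableForm_omega_pow`). Since `ω ^ n` lies in the span
of the magic `ψ_P`, to which the forms of magic sets are dual, it is nonzero iff one of these forms
is nonzero on it.

For the highest weight property, oddness lets any direction carry the normalization. Hence in each
direction `k! ω` is a sum of alternating functions of the vectors placed there, so `ω` and its
powers are fixed by transvections; differentiating gives annihilation by the raising operators. -/

theorem permSign_perm {n : ℕ} (e : Equiv.Perm (Fin n)) :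
    permSign (e : Fin n → Fin n) = (Equiv.Perm.sign e : ℤ) := by
  rw [permSign, dif_pos e.bijective]
  congr 2
  exact Equiv.ext fun _ => rfl

theorem permSign_of_not_bijective {n : ℕ} {a : Fin n → Fin n} (h : ¬ Function.Bijective a) :
    permSign a = 0 := dif_neg h

theorem permSign_comp_perm {n : ℕ} (a : Fin n → Fin n) (e : Equiv.Perm (Fin n)) :
    permSign (a ∘ e) = permSign a * (Equiv.Perm.sign e : ℤ) := by
  by_cases h : Function.Bijective a
  · obtain ⟨b, rfl⟩ : ∃ b : Equiv.Perm (Fin n), ⇑b = a := ⟨Equiv.ofBijective a h, rfl⟩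
    rw [← Equiv.Perm.coe_mul, permSign_perm, permSign_perm, Equiv.Perm.sign_mul, Units.val_mul]
  · rw [permSign_of_not_bijective h, permSign_of_not_bijective, zero_mul]
    exact fun h' => h (e.bijective_comp a |>.1 h')

theorem sign_mul_self {n : ℕ} (e : Equiv.Perm (Fin n)) :
    (Equiv.Perm.sign e : ℤ) * (Equiv.Perm.sign e : ℤ) = 1 := by
  rw [← Units.val_mul, Int.units_mul_self, Units.val_one]

/-- A map of the grid `[n] × [k]` preserving every column is bijective iff it is so on each column,
and its sign is then multiplicative over the columns. -/
theorem permSign_columnwise {n k : ℕ} (a : Fin k → Fin n → Fin n) :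
    permSign (fun m : Fin (n * k) => finProdFinEquiv
      (a (finProdFinEquiv.symm m).2 (finProdFinEquiv.symm m).1, (finProdFinEquiv.symm m).2)) =
    ∏ j, permSign (a j) := by
  by_cases h : ∀ j, Function.Bijective (a j)
  · obtain ⟨b, rfl⟩ : ∃ b : Fin k → Equiv.Perm (Fin n), (fun j => ⇑(b j)) = a :=
      ⟨fun j => Equiv.ofBijective _ (h j), rfl⟩
    simp only [permSign_perm]
    have := permSign_perm (finProdFinEquiv.permCongr (Equiv.prodCongrLeft b))
    rw [Equiv.Perm.sign_permCongr, Equiv.Perm.sign_prodCongrLeft, Units.coe_prod] at this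
    exact this
  · rw [permSign_of_not_bijective]
    · push Not at h
      obtain ⟨j, hj⟩ := h
      exact (Finset.prod_eq_zero (Finset.mem_univ j) (permSign_of_not_bijective hj)).symm
    · intro hb
      refine h fun j => Finite.injective_iff_bijective.1 fun x y hxy => ?_
      have := @hb.1 (finProdFinEquiv (x, j)) (finProdFinEquiv (y, j)) (by simp [hxy])
      simpa using this

theorem permSign_rowwise {n k : ℕ} (a : Fin n → Equiv.Perm (Fin k)) :
    permSign (fun m : Fin (n * k) => finProdFinEquiv
      ((finProdFinEquiv.symm m).1, a (finProdFinEquiv.symm m).1 (finProdFinEquiv.symm m).2)) =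
    ∏ c, (Equiv.Perm.sign (a c) : ℤ) := by
  have := permSign_perm (finProdFinEquiv.permCongr (Equiv.prodCongrRight a))
  rw [Equiv.Perm.sign_permCongr, Equiv.Perm.sign_prodCongrRight, Units.coe_prod] at this
  exact this

/-- For a word `r` in which every letter occurs `n` times, the word of the pairs `(C m, r m)`
has, up to a sign that does not depend on `C`, the product of the signs of `C` on the fibres of
`r`. -/
theorem exists_prod_wordSign_eq {n k : ℕ} (r : Fin (n * k) → Fin k)
    (hr : ∀ j, (Finset.univ.filter (fun m => r m = j)).card = n) :
    ∃ s : ℤ, s * s = 1 ∧ ∀ C : Fin (n * k) → Fin n,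
      ∏ j, wordSign (Finset.univ.filter (fun m => r m = j)) C =
        s * permSign (fun m => finProdFinEquiv (C m, r m)) := by
  -- `E` sends `(c, j)` to the `c`-th occurrence of the letter `j` in `r`. Precomposing with it
  -- turns the word of pairs into a columnwise one, and its sign is the required `s`.
  let E : Fin (n * k) → Fin (n * k) := fun m =>
    (Finset.univ.filter (fun m' => r m' = (finProdFinEquiv.symm m).2)).orderEmbOfFin (hr _)
      (finProdFinEquiv.symm m).1
  have hrE : ∀ m, r (E m) = (finProdFinEquiv.symm m).2 := fun m =>
    (Finset.mem_filter.1 (Finset.orderEmbOfFin_mem _ (hr (finProdFinEquiv.symm m).2)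
      (finProdFinEquiv.symm m).1)).2
  have hE : Function.Injective E := by
    intro x y hxy
    obtain ⟨⟨c, j⟩, rfl⟩ := finProdFinEquiv.surjective x
    obtain ⟨⟨c', j'⟩, rfl⟩ := finProdFinEquiv.surjective y
    have h2 : j = j' := by
      have := congrArg r hxy
      simpa [hrE] using this
    subst h2
    simp only [E, Equiv.symm_apply_apply, EmbeddingLike.apply_eq_iff_eq] at hxy
    rw [hxy]
  let e : Equiv.Perm (Fin (n * k)) := Equiv.ofBijective E (Finite.injective_iff_bijective.1 hE)
  refine ⟨Equiv.Perm.sign e, sign_mul_self e, fun C => ?_⟩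
  have h := permSign_columnwise (fun j i => C ((Finset.univ.filter
    (fun m' => r m' = j)).orderEmbOfFin (hr j) i))
  have h' : (fun m : Fin (n * k) => finProdFinEquiv (C (E m), (finProdFinEquiv.symm m).2)) =
      (fun m => finProdFinEquiv (C m, r m)) ∘ e := by
    funext m
    simp only [Function.comp, e, Equiv.ofBijective_apply, hrE]
  have h'' := permSign_comp_perm (fun m => finProdFinEquiv (C m, r m)) e
  rw [← h'] at h''
  refine Eq.trans (Eq.trans ?_ h.symm) (h''.trans (mul_comm _ _))
  refine Finset.prod_congr rfl fun j _ => ?_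
  rw [wordSign, dif_pos (hr j)]

/-! ### The value of `Δ_S` at the unit tensor -/

/-- The product of entries of the unit tensor vanishes unless all `σ l` coincide. -/
theorem Delta_unitTensor {d k M n : ℕ} (hd : 0 < d) (S : Fin d → Fin M → Fin k) :
    Delta S (unitTensor d n) =
      ((∑ C : Fin M → Fin n, ∏ l : Fin d, ∏ j : Fin k, wordSign (block S l j) C : ℤ) : ℂ) := by
  classical
  rw [Delta, Int.cast_sum]
  symm
  refine Finset.sum_of_injOn (fun C _ => C) ?_ (by simp) ?_ ?_
  · intro C _ C' _ h
    exact congrFun h ⟨0, hd⟩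
  · intro σ _ hσ
    have : ∃ m, ∃ l l', σ l m ≠ σ l' m := by
      by_contra! h
      exact hσ ⟨σ ⟨0, hd⟩, by simp, funext fun l => funext fun m => h m _ _⟩
    obtain ⟨m, l, l', hm⟩ := this
    rw [Finset.prod_eq_zero (Finset.mem_univ m), mul_zero]
    exact if_neg fun h => hm (h l l')
  · intro C _
    simp [unitTensor]

theorem IsMagic.card_slice {d k n : ℕ} {T : Finset (Cell d k)} (hT : IsMagic T)
    (hc : T.card = n * k) (l : Fin d) (i : Fin k) :
    (T.filter (fun x => coord x l = i)).card = n := by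
  obtain ⟨m, hm⟩ := hT
  have h := Finset.card_eq_sum_card_fiberwise (f := fun x => coord x l) (s := T)
    (t := Finset.univ) (fun _ _ => by simp)
  simp only [hm, Finset.sum_const, Finset.card_univ, Fintype.card_fin, smul_eq_mul, hc] at h
  rw [hm]
  exact (Nat.eq_of_mul_eq_mul_left i.pos (by rw [← h, mul_comm])).symm

theorem card_sliceOf {d k : ℕ} (T : Finset (Cell d k)) (l : Fin d) (i : Fin k) :
    (sliceOf T l i).card = (T.filter (fun x => coord x l = i)).card := by
  rw [sliceOf, Finset.univ_eq_attach, Finset.filter_attach (fun x => coord x l = i) T]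
  simp

/-- Transport of the sign of a word along an isomorphism of ordered sets. -/
theorem wordSign_map {α β : Type*} [LinearOrder α] [LinearOrder β] {n : ℕ} (e : α ≃o β)
    (A : Finset α) (B : Finset β) (h : ∀ x, e x ∈ B ↔ x ∈ A) (f : β → Fin n) :
    wordSign B f = wordSign A (f ∘ e) := by
  have hB : B = A.map e.toEquiv.toEmbedding := by
    ext y
    obtain ⟨x, rfl⟩ := e.surjective y
    simp [h]
  have hc : B.card = A.card := by rw [hB, Finset.card_map]
  unfold wordSign
  by_cases hA : A.card = n
  · rw [dif_pos hA, dif_pos (hc.trans hA)]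
    congr 1
    funext i
    have := Finset.orderEmbOfFin_unique (s := B) (hc.trans hA)
      (f := fun i => e (A.orderEmbOfFin hA i)) (fun i => by simp [h])
      (fun i j hij => by simpa using hij)
    simp [← this]
  · rw [dif_neg hA, dif_neg (fun h' => hA (hc.symm.trans h'))]

theorem block_tableOf {d k M : ℕ} (T : Finset (Cell d k)) (h : T.card = M) (l : Fin d)
    (j : Fin k) (m : Fin M) :
    T.orderIsoOfFin h m ∈ sliceOf T l j ↔ m ∈ block (tableOf T h) l j := by
  rw [sliceOf, block, Finset.mem_filter, Finset.mem_filter]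
  simp only [tableOf, Finset.mem_univ, true_and, Finset.coe_orderIsoOfFin_apply]

theorem isBalanced_tableOf {d k n : ℕ} {T : Finset (Cell d k)} (hT : IsMagic T)
    (h : T.card = n * k) : IsBalanced n (tableOf T h) := by
  intro l j
  refine Eq.trans ?_ ((card_sliceOf T l j).trans (hT.card_slice h l j))
  refine Finset.card_bij (fun m _ => T.orderIsoOfFin h m) ?_ ?_ ?_
  · exact fun m hm => (block_tableOf T h l j m).2 hm
  · exact fun _ _ _ _ h' => (T.orderIsoOfFin h).injective h'
  · intro x hx
    obtain ⟨m, rfl⟩ := (T.orderIsoOfFin h).surjective x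
    exact ⟨m, (block_tableOf T h l j m).1 hx, rfl⟩

theorem wordSign_of_not_isPermWord {α : Type*} [LinearOrder α] {n : ℕ} {A : Finset α}
    {f : α → Fin n} (h : ¬ IsPermWord A f) : wordSign A f = 0 := by
  unfold wordSign
  split_ifs with hA
  · exact permSign_of_not_bijective fun hb => h ⟨hA, hb⟩
  · rfl

/-- A filling that is not partial Latin has a slice of sign `0`, so the restriction on the sum can
be dropped. -/
theorem alonTarsi_eq_sum_fullSign {d k n : ℕ} {T : Finset (Cell d k)} (hT : IsMagic T)
    (hc : T.card = n * k) : alonTarsi n T = ∑ C : {x // x ∈ T} → Fin n, fullSign T C := by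
  classical
  rw [alonTarsi]
  refine Finset.sum_subset (Finset.filter_subset _ _) fun C _ hC => ?_
  have : ∃ l i, ¬ IsPermWord (sliceOf T l i) C := by
    by_contra! h
    exact hC (Finset.mem_filter.2 ⟨Finset.mem_univ _, hT, hc, h⟩)
  obtain ⟨l, i, h⟩ := this
  exact Finset.prod_eq_zero (Finset.mem_univ l)
    (Finset.prod_eq_zero (Finset.mem_univ i) (wordSign_of_not_isPermWord h))

theorem Delta_tableOf_unitTensor {d k n : ℕ} (hd : 0 < d) {T : Finset (Cell d k)}
    (hc : T.card = n * k) (hT : IsMagic T) :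
    Delta (tableOf T hc) (unitTensor d n) = (alonTarsi n T : ℂ) := by
  rw [Delta_unitTensor hd, alonTarsi_eq_sum_fullSign hT hc]
  congr 1
  symm
  refine Fintype.sum_equiv
    (Equiv.arrowCongr (T.orderIsoOfFin hc).symm.toEquiv (Equiv.refl _)) _ _ fun C => ?_
  refine Finset.prod_congr rfl fun l _ => Finset.prod_congr rfl fun j _ => ?_
  exact wordSign_map (T.orderIsoOfFin hc) _ _ (block_tableOf T hc l j) C

/-! ### Coordinate forms -/

/-- The coordinate of a tensor at the basis tensor of `x`. -/
def coordForm {d k : ℕ} (x : Fin d → Fin k) : TensorSpace d k →ₗ[ℂ] ℂ :=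
  PiTensorProduct.lift
    ((MultilinearMap.mkPiAlgebra ℂ (Fin d) ℂ).compLinearMap fun l => LinearMap.proj (x l))

theorem coordForm_basisTensor {d k : ℕ} (x y : Fin d → Fin k) :
    coordForm x (basisTensor y) = if x = y then 1 else 0 := by
  rw [coordForm, basisTensor, PiTensorProduct.lift.tprod]
  simp only [MultilinearMap.compLinearMap_apply, MultilinearMap.mkPiAlgebra_apply,
    LinearMap.proj_apply, Pi.single_apply, Finset.prod_ite_zero, Finset.prod_const_one, funext_iff,
    Finset.mem_univ, forall_true_left]

/-- The linear form on the exterior algebra given, in degree `M`, by the minor of coordinates at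
the columns of the table `S`. -/
def tableForm {d k M : ℕ} (S : Fin d → Fin M → Fin k) : Ext d k →ₗ[ℂ] ℂ :=
  ExteriorAlgebra.liftAlternating (Pi.single M
    (Matrix.detRowAlternating.compLinearMap (LinearMap.pi fun m => coordForm fun l => S l m)))

theorem tableForm_ιMulti {d k M : ℕ} (S : Fin d → Fin M → Fin k) (y : Fin M → Fin d → Fin k) :
    tableForm S (ExteriorAlgebra.ιMulti ℂ M fun m => basisTensor (y m)) =
      (Matrix.of fun m m' => if (fun l => S l m') = y m then (1 : ℂ) else 0).det := by
  rw [tableForm, ExteriorAlgebra.liftAlternating_apply_ιMulti, Pi.single_eq_same,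
    AlternatingMap.compLinearMap_apply]
  change Matrix.det _ = _
  congr 1
  ext m m'
  simp [coordForm_basisTensor]

theorem tableForm_ιMulti_eq_sum {d k M : ℕ} (S : Fin d → Fin M → Fin k)
    (y : Fin M → Fin d → Fin k) :
    tableForm S (ExteriorAlgebra.ιMulti ℂ M fun m => basisTensor (y m)) =
      ((∑ σ : Equiv.Perm (Fin M), if ∀ m l, S l m = y (σ m) l then
        (Equiv.Perm.sign σ : ℤ) else 0 : ℤ) : ℂ) := by
  rw [tableForm_ιMulti, Matrix.det_apply', Int.cast_sum]
  refine Finset.sum_congr rfl fun σ _ => ?_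
  simp only [Matrix.of_apply, Finset.prod_ite_zero, Finset.prod_const_one, funext_iff,
    Finset.mem_univ, forall_true_left]
  split_ifs <;> simp

/-! ### Powers of `ω` -/

/-- The tuples of permutations over which the sum that defines `ω` is taken. -/
def normalizedTuples (d k : ℕ) : Finset (Fin d → Equiv.Perm (Fin k)) :=
  Finset.univ.filter fun π => ∀ l : Fin d, (l : ℕ) = 0 → π l = 1

theorem ιMulti_flatten {V : Type*} [AddCommGroup V] [Module ℂ V] {n k : ℕ}
    (v : Fin n → Fin k → V) :
    (List.ofFn fun c => ExteriorAlgebra.ιMulti ℂ k (v c)).prod =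
      ExteriorAlgebra.ιMulti ℂ (n * k) fun m =>
        v (finProdFinEquiv.symm m).1 (finProdFinEquiv.symm m).2 := by
  rw [ExteriorAlgebra.ιMulti_apply, List.ofFn_mul, List.prod_flatten, List.map_ofFn]
  congr 2
  funext c
  rw [ExteriorAlgebra.ιMulti_apply, Function.comp_apply]
  congr 2
  funext i
  -- `finProdFinEquiv` numbers the grid row by row, in agreement with the concatenation of the
  -- lists.
  have : (⟨c * k + i, by
      calc
        (c : ℕ) * k + i < (c + 1) * k :=
          (Nat.add_lt_add_left i.prop _).trans_eq (by rw [Nat.add_mul, Nat.one_mul])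
        _ ≤ _ := Nat.mul_le_mul_right _ c.prop⟩ : Fin (n * k)) = finProdFinEquiv (c, i) := by
    ext
    simp [finProdFinEquiv, mul_comm, add_comm]
  rw [this, Equiv.symm_apply_apply]

theorem omega_eq {d k : ℕ} : omega d k = ∑ π ∈ normalizedTuples d k,
    ((∏ l : Fin d, (Equiv.Perm.sign (π l) : ℤ) : ℤ) : ℂ) •
      ExteriorAlgebra.ιMulti ℂ k (fun i => basisTensor (fun l => π l i)) := by
  rw [omega, normalizedTuples]

theorem omega_pow {d k : ℕ} (n : ℕ) : omega d k ^ n =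
    ∑ p ∈ Fintype.piFinset (fun _ : Fin n => normalizedTuples d k),
      ((∏ c, ∏ l, (Equiv.Perm.sign (p c l) : ℤ) : ℤ) : ℂ) •
        ExteriorAlgebra.ιMulti ℂ (n * k) fun m => basisTensor fun l =>
          p (finProdFinEquiv.symm m).1 l (finProdFinEquiv.symm m).2 := by
  rw [← MultilinearMap.mkPiAlgebraFin_apply_const (R := ℂ), omega_eq, MultilinearMap.map_sum_finset]
  refine Finset.sum_congr rfl fun p _ => ?_
  rw [MultilinearMap.map_smul_univ, MultilinearMap.mkPiAlgebraFin_apply, ιMulti_flatten,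
    Int.cast_prod]

/-- The combinatorial expansion behind `exists_tableForm_omega_pow`: a choice of a term in each factor of
`ω ^ n` and of a matching with the columns of `S` is the same as a filling `C` of the columns. -/
theorem sum_normalizedTuples_eq {d k n : ℕ} (hd : 0 < d) (hodd : Odd d)
    (S : Fin d → Fin (n * k) → Fin k) :
    ∑ p ∈ Fintype.piFinset (fun _ : Fin n => normalizedTuples d k),
      (∏ c, ∏ l, (Equiv.Perm.sign (p c l) : ℤ)) *
        ∑ σ : Equiv.Perm (Fin (n * k)),
          (if ∀ m l, S l m = p (finProdFinEquiv.symm (σ m)).1 l (finProdFinEquiv.symm (σ m)).2 then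
            (Equiv.Perm.sign σ : ℤ) else 0) =
    ∑ C : Fin (n * k) → Fin n, ∏ l, permSign fun m => finProdFinEquiv (C m, S l m) := by
  classical
  let l₀ : Fin d := ⟨0, hd⟩
  simp only [Finset.mul_sum, mul_ite, mul_zero]
  rw [← Finset.sum_product', ← Finset.sum_filter]
  have key : ∀ x : (Fin n → Fin d → Equiv.Perm (Fin k)) × Equiv.Perm (Fin (n * k)),
      (∀ m l, S l m = x.1 (finProdFinEquiv.symm (x.2 m)).1 l (finProdFinEquiv.symm (x.2 m)).2) →
      ∀ l, (fun m => finProdFinEquiv ((finProdFinEquiv.symm (x.2 m)).1, S l m)) =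
        (fun m : Fin (n * k) => finProdFinEquiv
      ((finProdFinEquiv.symm m).1,
        x.1 (finProdFinEquiv.symm m).1 l (finProdFinEquiv.symm m).2)) ∘ x.2 := by
    intro x hx l
    funext m
    simp only [hx, Function.comp_apply]
  have key₀ : ∀ x : (Fin n → Fin d → Equiv.Perm (Fin k)) × Equiv.Perm (Fin (n * k)),
      x.1 ∈ Fintype.piFinset (fun _ : Fin n => normalizedTuples d k) →
      (∀ m l, S l m = x.1 (finProdFinEquiv.symm (x.2 m)).1 l (finProdFinEquiv.symm (x.2 m)).2) →
      ∀ m, x.2 m = finProdFinEquiv ((finProdFinEquiv.symm (x.2 m)).1, S l₀ m) := by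
    -- The normalization in direction `l₀` makes row `l₀` of `S` the second grid coordinate of `σ
    -- m`, so `C` determines `σ`.
    intro x hx1 hx m
    have h1 : ∀ c, x.1 c l₀ = 1 := fun c =>
      (Finset.mem_filter.1 (Fintype.mem_piFinset.1 hx1 c)).2 l₀ rfl
    rw [hx m l₀, h1, Equiv.Perm.one_apply, Prod.mk.eta, Equiv.apply_symm_apply]
  refine Finset.sum_bij_ne_zero (fun x _ _ m => (finProdFinEquiv.symm (x.2 m)).1)
    (fun _ _ _ => Finset.mem_univ _) ?_ ?_ ?_
  · intro x hx _ y hy _ hxy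
    obtain ⟨hx1, hx⟩ := Finset.mem_filter.1 hx
    obtain ⟨hy1, hy⟩ := Finset.mem_filter.1 hy
    have hx1 := (Finset.mem_product.1 hx1).1
    have hy1 := (Finset.mem_product.1 hy1).1
    have h2 : x.2 = y.2 := by
      ext m : 1
      rw [key₀ x hx1 hx, key₀ y hy1 hy, congrFun hxy m]
    refine Prod.ext ?_ h2
    funext c l
    ext1 i
    obtain ⟨m, hm⟩ := x.2.surjective (finProdFinEquiv (c, i))
    have e1 := hx m l
    have e2 := hy m l
    rw [← h2] at e2
    rw [hm, Equiv.symm_apply_apply] at e1 e2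
    exact e1.symm.trans e2
  · intro C _ hC
    have hb : ∀ l, Function.Bijective fun m => finProdFinEquiv (C m, S l m) := by
      by_contra! h
      obtain ⟨l, hl⟩ := h
      exact hC (Finset.prod_eq_zero (Finset.mem_univ l) (permSign_of_not_bijective hl))
    let γ : Fin d → Equiv.Perm (Fin (n * k)) := fun l => Equiv.ofBijective _ (hb l)
    have hγ : ∀ l m, γ l m = finProdFinEquiv (C m, S l m) := fun _ _ => rfl
    -- The inverse construction: `(c, i)` labels the unique column with filling `c` and entry `i` in
    -- row `l₀`; the permutation of factor `c` in direction `l` reads off its entry in row `l`.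
    let q : Fin n → Fin d → Fin k → Fin k := fun c l i =>
      S l ((γ l₀).symm (finProdFinEquiv (c, i)))
    have hCγ : ∀ c i, C ((γ l₀).symm (finProdFinEquiv (c, i))) = c := by
      intro c i
      have h := (hγ l₀ ((γ l₀).symm (finProdFinEquiv (c, i)))).symm.trans
        ((γ l₀).apply_symm_apply _)
      exact congrArg Prod.fst (finProdFinEquiv.injective h)
    have hSγ : ∀ c i, S l₀ ((γ l₀).symm (finProdFinEquiv (c, i))) = i := by
      intro c i
      have h := (hγ l₀ ((γ l₀).symm (finProdFinEquiv (c, i)))).symm.trans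
        ((γ l₀).apply_symm_apply _)
      exact congrArg Prod.snd (finProdFinEquiv.injective h)
    have hq : ∀ c l, Function.Bijective (q c l) := by
      intro c l
      refine Finite.injective_iff_bijective.1 fun i j hij => ?_
      have h : γ l ((γ l₀).symm (finProdFinEquiv (c, i))) =
          γ l ((γ l₀).symm (finProdFinEquiv (c, j))) := by
        rw [hγ, hγ, hCγ, hCγ]
        exact congrArg (fun t => finProdFinEquiv (c, t)) hij
      simpa using h
    let p : Fin n → Fin d → Equiv.Perm (Fin k) := fun c l => Equiv.ofBijective _ (hq c l)
    have hx1 : p ∈ Fintype.piFinset (fun _ : Fin n => normalizedTuples d k) := by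
      refine Fintype.mem_piFinset.2 fun c => Finset.mem_filter.2 ⟨Finset.mem_univ _, ?_⟩
      intro l hl
      obtain rfl : l = l₀ := Fin.ext hl
      exact Equiv.ext fun i => hSγ c i
    have hx2 : ∀ m l, S l m =
        p (finProdFinEquiv.symm (γ l₀ m)).1 l (finProdFinEquiv.symm (γ l₀ m)).2 := by
      intro m l
      change _ = S l _
      rw [Prod.mk.eta, Equiv.apply_symm_apply, Equiv.symm_apply_apply]
    refine ⟨(p, γ l₀), Finset.mem_filter.2 ⟨Finset.mem_product.2 ⟨hx1, Finset.mem_univ _⟩, hx2⟩,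
      ?_, ?_⟩
    · have hs : ∀ u : ℤˣ, (u : ℤ) ≠ 0 := fun u => u.ne_zero
      exact mul_ne_zero (Finset.prod_ne_zero_iff.2 fun c _ =>
        Finset.prod_ne_zero_iff.2 fun l _ => hs _) (hs _)
    · funext m
      simp [hγ]
  · intro x hx _
    obtain ⟨hx1, hx⟩ := Finset.mem_filter.1 hx
    have hp : ∀ l, (permSign fun m => finProdFinEquiv ((finProdFinEquiv.symm (x.2 m)).1, S l m)) =
        (∏ c, (Equiv.Perm.sign (x.1 c l) : ℤ)) * (Equiv.Perm.sign x.2 : ℤ) := by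
      intro l
      rw [key x hx l, permSign_comp_perm, permSign_rowwise fun c => x.1 c l]
    simp only [hp, Finset.prod_mul_distrib, Finset.prod_const, Finset.card_univ, Fintype.card_fin]
    rw [Finset.prod_comm]
    congr 1
    -- The sign of `σ` occurs once per direction; an odd power of it is the sign itself.
    obtain ⟨t, rfl⟩ := hodd
    rw [pow_succ, pow_mul, pow_two, sign_mul_self, one_pow, one_mul]

/-- Up to a sign, the value of the form of `S` at `ω ^ n` is the value of `Δ_S` at the unit
tensor. -/
theorem exists_tableForm_omega_pow {d k n : ℕ} (hd : 0 < d) (hodd : Odd d)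
    (S : Fin d → Fin (n * k) → Fin k) (hS : IsBalanced n S) :
    ∃ s : ℂ, s ≠ 0 ∧ Delta S (unitTensor d n) = s * tableForm S (omega d k ^ n) := by
  choose s hs hsC using fun l => exists_prod_wordSign_eq (S l) (hS l)
  have hne : ∏ l, s l ≠ 0 := Finset.prod_ne_zero_iff.2 fun l _ h => by simpa [h] using hs l
  refine ⟨((∏ l, s l : ℤ) : ℂ), Int.cast_ne_zero.2 hne, ?_⟩
  have h : tableForm S (omega d k ^ n) =
      ((∑ C : Fin (n * k) → Fin n, ∏ l, permSign fun m => finProdFinEquiv (C m, S l m) : ℤ) :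
        ℂ) := by
    rw [← sum_normalizedTuples_eq hd hodd S, omega_pow, map_sum, Int.cast_sum]
    refine Finset.sum_congr rfl fun p _ => ?_
    rw [map_smul, tableForm_ιMulti_eq_sum S, smul_eq_mul, Int.cast_mul]
  rw [h, Delta_unitTensor hd, ← Int.cast_mul, Finset.mul_sum]
  congr 1
  refine Finset.sum_congr rfl fun C _ => ?_
  rw [← Finset.prod_mul_distrib]
  exact Finset.prod_congr rfl fun l _ => hsC l C

/-! ### The span of the `ψ_P` -/

theorem psi_eq_ιMulti {d k M : ℕ} (P : Finset (Cell d k)) (h : P.card = M) :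
    psi P = ExteriorAlgebra.ιMulti ℂ M fun i => basisTensor (ofLex (P.orderEmbOfFin h i)) := by
  subst h
  rfl

/-- Duality of the forms with the `ψ_P`: the minor is an identity matrix if `T = P`, and otherwise a
cell of `P` outside `T` gives a zero row. -/
theorem tableForm_psi {d k M : ℕ} (T P : Finset (Cell d k)) (hT : T.card = M) (hP : P.card = M) :
    tableForm (tableOf T hT) (psi P) = if T = P then 1 else 0 := by
  have hcol : ∀ (m : Fin M) (y : Cell d k),
      (fun l => tableOf T hT l m) = ofLex y ↔ T.orderEmbOfFin hT m = y := fun m y =>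
    ⟨fun h => ofLex.injective h, fun h => by rw [← h]; rfl⟩
  rw [psi_eq_ιMulti P hP, tableForm_ιMulti]
  split_ifs with h
  · subst h
    convert Matrix.det_one (n := Fin M) (R := ℂ)
    ext m m'
    rw [Matrix.of_apply, Matrix.one_apply]
    simp only [hcol, EmbeddingLike.apply_eq_iff_eq, eq_comm]
  · have : ∃ x ∈ P, x ∉ T := by
      by_contra! hsub
      exact h (Finset.eq_of_subset_of_card_le hsub (by rw [hT, hP])).symm
    obtain ⟨x, hxP, hxT⟩ := this
    obtain ⟨m, hm⟩ : ∃ m, P.orderEmbOfFin hP m = x := by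
      have : x ∈ Set.range (P.orderEmbOfFin hP) := by simpa using hxP
      exact this
    refine Matrix.det_eq_zero_of_row_eq_zero m fun m' => ?_
    rw [Matrix.of_apply, if_neg]
    rw [hcol, hm]
    rintro rfl
    exact hxT (Finset.orderEmbOfFin_mem _ _ _)

theorem eq_zero_of_tableForm_eq_zero {d k n : ℕ} {v : Ext d k} (hv : v ∈ magicSpace d k n)
    (h : ∀ (T : Finset (Cell d k)) (hT : T.card = n * k), IsMagic T →
      tableForm (tableOf T hT) v = 0) : v = 0 := by
  classical
  -- By duality this operator fixes each magic `ψ_P`, hence all of their span.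
  let F : Ext d k →ₗ[ℂ] Ext d k := ∑ T : Finset (Cell d k),
    if hT : T.card = n * k ∧ IsMagic T then
      (tableForm (tableOf T hT.1)).smulRight (psi T) else (0 : Ext d k →ₗ[ℂ] Ext d k)
  have hF : ∀ w, F w = ∑ T : Finset (Cell d k), if hT : T.card = n * k ∧ IsMagic T then
      tableForm (tableOf T hT.1) w • psi T else 0 := by
    intro w
    rw [LinearMap.sum_apply]
    refine Finset.sum_congr rfl fun T _ => ?_
    split_ifs <;> simp
  have hid : Set.EqOn F (LinearMap.id : Ext d k →ₗ[ℂ] Ext d k)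
      {v | ∃ P : Finset (Cell d k), IsMagic P ∧ P.card = n * k ∧ v = psi P} := by
    rintro _ ⟨P, hP, hPc, rfl⟩
    rw [hF, Finset.sum_eq_single P, dif_pos ⟨hPc, hP⟩, tableForm_psi P P hPc hPc, if_pos rfl,
      one_smul, LinearMap.id_apply]
    · intro T _ hTP
      split_ifs with hT
      · rw [tableForm_psi T P hT.1 hPc, if_neg hTP, zero_smul]
      · rfl
    · simp
  have hv' := LinearMap.eqOn_span hid hv
  rw [LinearMap.id_apply] at hv'
  rw [← hv', hF]
  refine Finset.sum_eq_zero fun T _ => ?_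
  split_ifs with hT
  · rw [h T hT.1 hT.2, zero_smul]
  · rfl

/-- A repeated factor kills the wedge; distinct factors can be sorted at the cost of a sign, and the
counting hypothesis makes their set magic. -/
theorem ιMulti_mem_magicSpace {d k n : ℕ} (y : Fin (n * k) → Fin d → Fin k)
    (hy : ∀ l j, (Finset.univ.filter fun m => y m l = j).card = n) :
    ExteriorAlgebra.ιMulti ℂ (n * k) (fun m => basisTensor (y m)) ∈ magicSpace d k n := by
  classical
  by_cases hinj : Function.Injective y
  · let z : Fin (n * k) ↪ Cell d k := ⟨fun m => toLex (y m), fun a b h => hinj (toLex.injective h)⟩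
    let P : Finset (Cell d k) := Finset.univ.map z
    have hP : P.card = n * k := by simp [P]
    let e : Fin (n * k) ≃ Fin (n * k) := Equiv.ofBijective
      (fun m => (P.orderIsoOfFin hP).symm ⟨z m, by simp [P]⟩)
      (Finite.injective_iff_bijective.1 fun a b h => by simpa using h)
    have he : ∀ m, ofLex (P.orderEmbOfFin hP (e m)) = y m := by
      intro m
      rw [← Finset.coe_orderIsoOfFin_apply]
      simp only [e, Equiv.ofBijective_apply, OrderIso.apply_symm_apply]
      rfl
    have hmagic : IsMagic P := by
      refine ⟨n, fun l j => Eq.trans ?_ (hy l j)⟩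
      rw [Finset.filter_map, Finset.card_map]
      rfl
    have : (fun m => basisTensor (y m)) =
        (fun m => basisTensor (ofLex (P.orderEmbOfFin hP m))) ∘ e := by
      funext m
      rw [Function.comp_apply, he]
    rw [this, AlternatingMap.map_perm, ← psi_eq_ιMulti P hP, Units.smul_def]
    have hmem : psi P ∈ magicSpace d k n := Submodule.subset_span ⟨P, hmagic, hP, rfl⟩
    exact zsmul_mem hmem _
  · rw [AlternatingMap.map_eq_zero_of_not_injective]
    · exact zero_mem _
    · exact fun h => hinj fun a b hab => h (by simp [hab])

/-- In each direction, every one of the `n` factors `ω` uses each letter exactly once. -/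
theorem omega_pow_mem_magicSpace (d k n : ℕ) : omega d k ^ n ∈ magicSpace d k n := by
  rw [omega_pow]
  refine Submodule.sum_mem _ fun p _ => Submodule.smul_mem _ _ (ιMulti_mem_magicSpace _ fun l j => ?_)
  refine Eq.trans ?_ (Fintype.card_fin n)
  rw [← Finset.card_univ]
  refine (Finset.card_bij (fun c _ => finProdFinEquiv (c, (p c l).symm j)) ?_ ?_ ?_).symm
  · intro c _
    refine Finset.mem_filter.2 ⟨Finset.mem_univ _, ?_⟩
    rw [Equiv.symm_apply_apply]
    exact (p c l).apply_symm_apply j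
  · intro c _ c' _ h
    exact congrArg Prod.fst (finProdFinEquiv.injective h)
  · intro m hm
    refine ⟨(finProdFinEquiv.symm m).1, Finset.mem_univ _, ?_⟩
    rw [← (Finset.mem_filter.1 hm).2, Equiv.symm_apply_apply, Prod.mk.eta,
      Equiv.apply_symm_apply]

/-! ### `ω` is annihilated by the raising operators -/

theorem tensorAct_tprod {d k : ℕ} (g : Fin d → Matrix (Fin k) (Fin k) ℂ)
    (v : Fin d → Fin k → ℂ) :
    tensorAct g (PiTensorProduct.tprod ℂ v) = PiTensorProduct.tprod ℂ fun l => (g l).mulVec (v l) := by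
  rw [tensorAct, PiTensorProduct.map_tprod]
  simp [Matrix.toLin'_apply]

theorem isWeightVector_omega (d k : ℕ) : IsWeightVector (fun _ _ => 1) (omega d k) := by
  intro a
  rw [omega_eq, map_sum, Finset.smul_sum]
  refine Finset.sum_congr rfl fun π _ => ?_
  rw [map_smul, extAct, ExteriorAlgebra.map_apply_ιMulti, smul_comm]
  congr 1
  have h : ∀ i, tensorAct (fun l => Matrix.diagonal fun i => (a l i : ℂ))
      (basisTensor fun l => π l i) = (∏ l, (a l (π l i) : ℂ)) • basisTensor fun l => π l i := by
    intro i
    rw [basisTensor, tensorAct_tprod, ← MultilinearMap.map_smul_univ]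
    congr 1
    funext l
    rw [Matrix.diagonal_mulVec_single, mul_one, ← Pi.single_smul, smul_eq_mul, mul_one]
  simp only [Function.comp_def, h, pow_one]
  rw [← AlternatingMap.coe_multilinearMap, MultilinearMap.map_smul_univ, Finset.prod_comm]
  congr 1
  exact Finset.prod_congr rfl fun l _ => Equiv.prod_comp (π l) fun i => (a l i : ℂ)

theorem IsWeightVector.pow {d k : ℕ} {v : Ext d k} (h : IsWeightVector (fun _ _ => 1) v) (n : ℕ) :
    IsWeightVector (fun _ _ => n) (v ^ n) := by
  intro a
  rw [map_pow, h a, smul_pow]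
  simp only [pow_one, Finset.prod_pow]

/-- As the number of directions is odd, any direction can be used to normalize the tuples of
permutations in the sum that defines `ω`. -/
theorem omega_eq_sum_filter {d k : ℕ} (hd : 0 < d) (hodd : Odd d) (l' : Fin d) :
    omega d k = ∑ π : Fin d → Equiv.Perm (Fin k) with π l' = 1,
    ((∏ l : Fin d, (Equiv.Perm.sign (π l) : ℤ) : ℤ) : ℂ) •
      ExteriorAlgebra.ιMulti ℂ k (fun i => basisTensor (fun l => π l i)) := by
  let l₀ : Fin d := ⟨0, hd⟩
  rw [omega_eq]
  -- Right translation of a tuple by one permutation only reorders the wedge factors.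
  refine Finset.sum_nbij' (fun π l => π l * (π l')⁻¹) (fun π l => π l * (π l₀)⁻¹) ?_ ?_ ?_ ?_ ?_
  · simp
  · intro π _
    refine Finset.mem_filter.2 ⟨Finset.mem_univ _, fun l hl => ?_⟩
    obtain rfl : l = l₀ := Fin.ext hl
    simp
  · intro π hπ
    have := (Finset.mem_filter.1 hπ).2 l₀ rfl
    simp [this]
  · intro π hπ
    have := (Finset.mem_filter.1 hπ).2
    simp [this]
  · intro π _
    have h := AlternatingMap.map_perm (ExteriorAlgebra.ιMulti ℂ k)
      (fun i => basisTensor (fun l => π l i)) (π l')⁻¹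
    simp only [Function.comp_def] at h
    simp only [Equiv.Perm.mul_apply, h, Equiv.Perm.sign_mul, Equiv.Perm.sign_inv]
    rw [Units.smul_def, ← Int.cast_smul_eq_zsmul ℂ, smul_smul, ← Int.cast_mul]
    congr 2
    simp only [Units.val_mul, Finset.prod_mul_distrib, Finset.prod_const, Finset.card_univ,
      Fintype.card_fin]
    obtain ⟨t, rfl⟩ := hodd
    -- The sign of `π l'` occurs `d` times from the tuple and once from reordering the wedge: an
    -- even power.
    rw [mul_assoc, ← pow_succ, show 2 * t + 1 + 1 = 2 * (t + 1) by ring, pow_mul, pow_two,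
      sign_mul_self, one_pow, mul_one]

/-- The wedge product of the basis tensors of the tuple `π`, with the factors in direction `l`
replaced by arbitrary vectors. -/
def directionMultilinear {d k : ℕ} (l : Fin d) (π : Fin d → Equiv.Perm (Fin k)) :
    MultilinearMap ℂ (fun _ : Fin k => (Fin k → ℂ)) (Ext d k) :=
  (ExteriorAlgebra.ιMulti ℂ k).toMultilinearMap.compLinearMap fun i =>
    (PiTensorProduct.tprod ℂ (s := fun _ : Fin d => (Fin k → ℂ))).toLinearMap
      (fun l' => Pi.single (π l' i) 1) l

theorem directionMultilinear_apply {d k : ℕ} (l : Fin d) (π : Fin d → Equiv.Perm (Fin k))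
    (v : Fin k → Fin k → ℂ) : directionMultilinear l π v = ExteriorAlgebra.ιMulti ℂ k fun i =>
      PiTensorProduct.tprod ℂ (Function.update (fun l' => Pi.single (π l' i) 1) l (v i)) := rfl

/-- With the normalization moved to `l' ≠ l`, the permutation in direction `l` runs freely. Each of
the `k!` terms of the alternatization then reproduces `ω` after reindexing, and the result is
alternating in the vectors in direction `l`. -/
theorem factorial_smul_omega {d k : ℕ} (hd : 0 < d) (hodd : Odd d) {l l' : Fin d} (hl : l' ≠ l) :
    (Nat.factorial k) • omega d k = ∑ π : Fin d → Equiv.Perm (Fin k) with π l' = 1,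
      ((∏ l : Fin d, (Equiv.Perm.sign (π l) : ℤ) : ℤ) : ℂ) •
        MultilinearMap.alternatization (directionMultilinear l π)
          (fun i => Pi.single (π l i) (1 : ℂ)) := by
  simp only [MultilinearMap.alternatization_apply, Finset.smul_sum]
  rw [Finset.sum_comm]
  have hcard : Nat.factorial k = (Finset.univ : Finset (Equiv.Perm (Fin k))).card := by
    rw [Finset.card_univ, Fintype.card_perm, Fintype.card_fin]
  rw [hcard, ← Finset.sum_const]
  refine Finset.sum_congr rfl fun ρ _ => ?_
  rw [omega_eq_sum_filter hd hodd l']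
  refine Finset.sum_nbij' (fun π => Function.update π l (π l * ρ⁻¹))
    (fun π => Function.update π l (π l * ρ)) ?_ ?_ ?_ ?_ ?_
  · intro π hπ
    simpa [hl] using hπ
  · intro π hπ
    simpa [hl] using hπ
  · intro π _
    simp
  · intro π _
    simp
  · intro π _
    rw [MultilinearMap.domDomCongr_apply, directionMultilinear_apply, Units.smul_def,
      ← Int.cast_smul_eq_zsmul ℂ, smul_smul, ← Int.cast_mul]
    congr 2
    · rw [← Finset.mul_prod_erase _ _ (Finset.mem_univ l),
        ← Finset.mul_prod_erase _ _ (Finset.mem_univ l), Function.update_self,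
        Equiv.Perm.sign_mul, Equiv.Perm.sign_inv, Units.val_mul, mul_right_comm, mul_assoc,
        mul_assoc, ← mul_assoc (Equiv.Perm.sign ρ : ℤ),
        sign_mul_self, one_mul]
      congr 1
      refine Finset.prod_congr rfl fun m hm => ?_
      rw [Function.update_of_ne (Finset.ne_of_mem_erase hm)]
    · funext i
      rw [basisTensor]
      congr 1
      funext m
      by_cases hm : m = l
      · subst hm
        simp
      · simp [hm]

theorem extAct_alternatization {d k : ℕ} (l : Fin d) (g : Matrix (Fin k) (Fin k) ℂ)
    (π : Fin d → Equiv.Perm (Fin k)) (v : Fin k → Fin k → ℂ) :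
    extAct (Function.update 1 l g) (MultilinearMap.alternatization (directionMultilinear l π) v) =
      MultilinearMap.alternatization (directionMultilinear l π) fun i => g.mulVec (v i) := by
  simp only [MultilinearMap.alternatization_apply, map_sum]
  refine Finset.sum_congr rfl fun ρ _ => ?_
  rw [Units.smul_def, Units.smul_def, map_zsmul]
  congr 1
  rw [MultilinearMap.domDomCongr_apply, MultilinearMap.domDomCongr_apply,
    directionMultilinear_apply, directionMultilinear_apply, extAct,
    ExteriorAlgebra.map_apply_ιMulti]
  congr 1
  funext i
  rw [Function.comp_apply, tensorAct_tprod]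
  congr 1
  funext m
  by_cases hm : m = l
  · subst hm
    simp
  · rw [Function.update_of_ne hm, Function.update_of_ne hm, Function.update_of_ne hm, Pi.one_apply,
      Matrix.one_mulVec]

/-- A transvection changes only `e_j`, into `e_j + ε e_i`. As `e_i` is already an argument of the
alternating map, the added term vanishes. -/
theorem extAct_transvection_omega {d k : ℕ} (hd : 2 ≤ d) (hodd : Odd d) (l : Fin d) {i j : Fin k}
    (hij : i ≠ j) (ε : ℂ) :
    extAct (Function.update 1 l (1 + ε • Matrix.single i j 1)) (omega d k) = omega d k := by
  have : Nontrivial (Fin d) := Fin.nontrivial_iff_two_le.2 hd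
  obtain ⟨l', hl⟩ := exists_ne l
  have hk : (Nat.factorial k : ℂ) ≠ 0 := Nat.cast_ne_zero.2 (Nat.factorial_ne_zero k)
  refine smul_right_injective _ hk ?_
  simp only
  rw [← map_smul, Nat.cast_smul_eq_nsmul, factorial_smul_omega (by omega) hodd hl, map_sum]
  refine Finset.sum_congr rfl fun π _ => ?_
  rw [map_smul, extAct_alternatization]
  congr 1
  set v : Fin k → Fin k → ℂ := fun i => Pi.single (π l i) 1 with hv
  have hupd : (fun t => (1 + ε • Matrix.single i j (1 : ℂ)).mulVec (v t)) =
      Function.update v ((π l).symm j)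
        (v ((π l).symm j) + ε • v ((π l).symm i)) := by
    funext t
    by_cases ht : t = (π l).symm j
    · subst ht
      rw [Function.update_self, Matrix.add_mulVec, Matrix.one_mulVec, Matrix.smul_mulVec,
        Matrix.single_mulVec]
      simp [hv, Pi.single]
    · have : π l t ≠ j := fun h => ht (by rw [← h, Equiv.symm_apply_apply])
      rw [Function.update_of_ne ht, Matrix.add_mulVec, Matrix.one_mulVec, Matrix.smul_mulVec,
        Matrix.single_mulVec]
      simp [hv, this.symm]
  have hne : (π l).symm j ≠ (π l).symm i := fun h => hij ((π l).symm.injective h).symm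
  rw [hupd, AlternatingMap.map_update_add, AlternatingMap.map_update_smul,
    AlternatingMap.map_update_self _ v hne, smul_zero, add_zero, Function.update_eq_self]

theorem raising_omega_pow {d k : ℕ} (hd : 2 ≤ d) (hodd : Odd d) (l : Fin d) {i j : Fin k}
    (hij : i ≠ j) (n : ℕ) : raising l i j (omega d k ^ n) = 0 := by
  rw [← Module.forall_dual_apply_eq_zero_iff ℂ]
  intro φ
  have h := hasDerivAt_extAct l (Matrix.single i j 1) (omega d k ^ n) φ
  simp only [map_pow, extAct_transvection_omega hd hodd l hij] at h
  -- The orbit of `ω ^ n` under `1 + ε E_{i,j}` is constant, so its derivative at `0` vanishes.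
  exact h.unique (hasDerivAt_const _ _)

end HyperDet

end

open HyperDet
theorem corollary8 (d k n : ℕ) (hd : 3 ≤ d) (hodd : Odd d) (hn : 2 ≤ n) (hnk : n ≤ k ^ (d - 1)) :
    (∀ (T : Finset (Cell d k)) (hT : T.card = n * k), IsMagic T →
      Delta (tableOf T hT) (unitTensor d n) = (alonTarsi n T : ℂ)) ∧
    [ omega d k ^ n ≠ 0,
      ∃ (T : Finset (Cell d k)) (hT : T.card = n * k), IsMagic T ∧
        Delta (tableOf T hT) (unitTensor d n) = (alonTarsi n T : ℂ) ∧ alonTarsi n T ≠ 0,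
      ∃ S : Fin d → Fin (n * k) → Fin k, IsBalanced n S ∧ Delta S (unitTensor d n) ≠ 0,
      ∀ i : ℕ, 1 ≤ i → i ≤ n → omega d k ^ i ∈ magicSpace d k i ∧
        IsHighestWeightVector (fun _ _ => i) (omega d k ^ i) ].TFAE := by
  have hd0 : 0 < d := by omega
  have hΔ : ∀ (T : Finset (Cell d k)) (hT : T.card = n * k), IsMagic T →
      Delta (tableOf T hT) (unitTensor d n) = (alonTarsi n T : ℂ) :=
    fun T hT hm => Delta_tableOf_unitTensor hd0 hT hm
  refine ⟨hΔ, ?_⟩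
  tfae_have 1 → 2 := by
    intro h
    by_contra! hall
    refine h (eq_zero_of_tableForm_eq_zero (omega_pow_mem_magicSpace d k n) fun T hT hm => ?_)
    obtain ⟨s, hs, hsΔ⟩ := exists_tableForm_omega_pow hd0 hodd _ (isBalanced_tableOf hm hT)
    rw [hΔ T hT hm, hall T hT hm (hΔ T hT hm), Int.cast_zero] at hsΔ
    exact (mul_eq_zero.1 hsΔ.symm).resolve_left hs
  tfae_have 2 → 3 := by
    rintro ⟨T, hT, hm, h, hne⟩
    exact ⟨tableOf T hT, isBalanced_tableOf hm hT, by rw [h]; exact Int.cast_ne_zero.2 hne⟩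
  tfae_have 3 → 1 := by
    rintro ⟨S, hS, hne⟩ h0
    obtain ⟨s, -, hsΔ⟩ := exists_tableForm_omega_pow hd0 hodd S hS
    rw [h0, map_zero, mul_zero] at hsΔ
    exact hne hsΔ
  tfae_have 1 → 4 := by
    intro h i _ hi
    refine ⟨omega_pow_mem_magicSpace d k i, fun h0 => h ?_, (isWeightVector_omega d k).pow i,
      fun l a b hab => raising_omega_pow (by omega) hodd l hab.ne i⟩
    -- `ω ^ i` divides `ω ^ n`, so it cannot vanish.
    rw [← Nat.add_sub_cancel' hi, pow_add, h0, zero_mul]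
  tfae_have 4 → 1 := fun h => (h n (by omega) le_rfl).2.ne_zero
  tfae_finish
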